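/- Let $p=(p_x)_{x\in\mathbb N}$, $\mathbb N=\{0,1,2,\dots\}$, be a nonincreasing probability mass function and let $X_1,X_2,\dots$ be i.i.d. $\mathbb N$-valued random variables with mass function $p$. For a vector $w=(w_0,\dots,w_k)$ let $\mathrm{rear}(w)$ be the vector of its entries in nonincreasing order, and let $\mathrm{gren}(w)$ be the vector of the $k+1$ slopes, over $[x-1,x]$, $x=0,\dots,k$, of the least concave majorant of the points $\bigl(j,\sum_{i=0}^j w_i\bigr)$, $j=-1,0,\dots,k$ (the empty sum being $0$). Let $\widehat p_{n,x}=n^{-1}\#\{i\le n: X_i=x\}$ be the empirical estimator, and let $\widehat p_n^R$ and $\widehat p_n^G$ be the rearrangement and Grenander estimators, obtained by applying $\mathrm{rear}$ and $\mathrm{gren}$ to $(\widehat p_{n,0},\dots,\widehat p_{n,M_n})$, $M_n=\max\{X_1,\dots,X_n\}$, and extending by zero. Put $Y_{n,x}=\sqrt n(\widehat p_{n,x}-p_x)$, $Y^R_{n,x}=\sqrt n(\widehat p^R_{n,x}-p_x)$, $Y^G_{n,x}=\sqrt n(\widehat p^G_{n,x}-p_x)$. Let $Y$ be a Gaussian random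 element of $\ell_2$ with mean zero and covariances $E[Y_xY_z]=p_x\delta_{x,z}-p_xp_z$. For a sequence $q$ write $q^{(r,s)}=(q_r,\dots,q_s)$. Suppose that $r\le s$ in $\mathbb N$ satisfy $p_{r-1}>p_r>\dots>p_s>p_{s+1}$ (where the condition $p_{r-1}>p_r$ is void if $r=0$). Then, as $n\to\infty$, $$Y_n^{(r,s)}\to_d Y^{(r,s)},\qquad (Y_n^R)^{(r,s)}\to_d Y^{(r,s)},\qquad (Y_n^G)^{(r,s)}\to_d Y^{(r,s)}\qquad\text{in }\mathbb R^{s-r+1},$$ and $\sqrt n\,(\widehat p^G_{n,x}-\widehat p_{n,x})\to 0$ in probability for every $x\in\{r,\dots,s\}$. -/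

import Mathlib

open MeasureTheory ProbabilityTheory Filter
open scoped Topology

noncomputable section

namespace DiscreteMonotone

/-- `rear w`: the entries of the vector `w`, listed in nonincreasing order. -/
def rear {k : ℕ} (w : Fin (k + 1) → ℝ) : Fin (k + 1) → ℝ :=
  fun i => w (Tuple.sort (fun j => -w j) i)

/-- Value at `t` of the least concave majorant, on the set `D`, of a set `Q` of points of the
plane: the infimum at `t` of all functions that are concave on `D` and lie above every point
of `Q`. -/
def leastConcaveMajorant (D : Set ℝ) (Q : Set (ℝ × ℝ)) (t : ℝ) : ℝ :=
  sInf {v : ℝ | ∃ g : ℝ → ℝ, ConcaveOn ℝ D g ∧ (∀ q ∈ Q, q.2 ≤ g q.1) ∧ v = g t}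

/-- The points `(j, w 0 + ⋯ + w j)` for `j = -1, 0, …, k` (the empty sum being `0`). -/
def cumulativePoints {k : ℕ} (w : Fin (k + 1) → ℝ) : Set (ℝ × ℝ) :=
  {q | ∃ m : ℕ, m ≤ k + 1 ∧
    q = ((m : ℝ) - 1, ∑ i : Fin (k + 1), if (i : ℕ) < m then w i else 0)}

/-- `gren w`: the slopes, on the unit intervals `[i - 1, i]` with `i = 0, …, k`, of the least
concave majorant of the cumulative points of the vector `w`. -/
def gren {k : ℕ} (w : Fin (k + 1) → ℝ) : Fin (k + 1) → ℝ :=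
  fun i =>
    leastConcaveMajorant (Set.Icc (-1) (k : ℝ)) (cumulativePoints w) (i : ℕ) -
      leastConcaveMajorant (Set.Icc (-1) (k : ℝ)) (cumulativePoints w) (((i : ℕ) : ℝ) - 1)

/-- Applies an operator on vectors to the initial part `(w 0, …, w M)` of a sequence, and extends
the result by zero. -/
def applyUpTo (φ : ∀ {k : ℕ}, (Fin (k + 1) → ℝ) → Fin (k + 1) → ℝ) (M : ℕ) (w : ℕ → ℝ) :
    ℕ → ℝ :=
  fun x => if h : x < M + 1 then φ (fun i : Fin (M + 1) => w i) ⟨x, h⟩ else 0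

variable {Ω : Type*}

/-- The empirical estimator from the first `n` observations `X 0, …, X (n - 1)`:
the proportion of the observations that are equal to `x`. -/
def empirical (X : ℕ → Ω → ℕ) (n : ℕ) (ω : Ω) : ℕ → ℝ :=
  fun x => (n : ℝ)⁻¹ * ∑ i ∈ Finset.range n, if X i ω = x then 1 else 0

/-- The largest of the first `n` observations. -/
def sampleMax (X : ℕ → Ω → ℕ) (n : ℕ) (ω : Ω) : ℕ :=
  (Finset.range n).sup fun i => X i ω

/-- The rearrangement estimator: the empirical proportions in nonincreasing order. -/
def rearrangementEstimator (X : ℕ → Ω → ℕ) (n : ℕ) (ω : Ω) : ℕ → ℝ :=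
  applyUpTo rear (sampleMax X n ω) (empirical X n ω)

/-- The Grenander estimator, that is, the maximum likelihood estimator among nonincreasing
mass functions: the slopes of the least concave majorant of the empirical distribution function. -/
def grenanderEstimator (X : ℕ → Ω → ℕ) (n : ℕ) (ω : Ω) : ℕ → ℝ :=
  applyUpTo gren (sampleMax X n ω) (empirical X n ω)

/-- The fluctuation `√n (q - p)` of an estimate `q` of `p` from `n` observations. -/
def fluctuation (n : ℕ) (q p : ℕ → ℝ) : ℕ → ℝ :=
  fun x => √(n : ℝ) * (q x - p x)

/-- The part `(q r, …, q s)` of a sequence `q`. -/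
def segment (r s : ℕ) (q : ℕ → ℝ) : Finset.Icc r s → ℝ :=
  fun x => q x

/-- The Hilbert space of square summable real sequences. -/
abbrev Ell2 : Type := lp (fun _ : ℕ => ℝ) 2

instance instMeasurableSpaceEll2 : MeasurableSpace Ell2 := borel Ell2

instance instBorelSpaceEll2 : BorelSpace Ell2 := ⟨rfl⟩

/-- `Y` is a Gaussian random element of `ℓ²` with mean zero and covariance operator `S` given by
`⟪S e_x, e_z⟫ = p x * δ_{x,z} - p x * p z`; here `⟪S e_x, e_z⟫` is the covariance of the
coordinates `Y_x = ⟪Y, e_x⟫` and `Y_z = ⟪Y, e_z⟫`. -/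
structure IsLimitProcess (p : ℕ → ℝ) {Ω' : Type*} [MeasurableSpace Ω'] (P' : Measure Ω')
    (Y : Ω' → Ell2) : Prop where
  gaussian : HasGaussianLaw Y P'
  mean_zero : ∫ ω, Y ω ∂P' = 0
  covariance : ∀ x z : ℕ,
    cov[fun ω => Y ω x, fun ω => Y ω z; P'] = (if x = z then p x else 0) - p x * p z

end DiscreteMonotone

end

/-!
If `p` drops strictly into and out of `x`, then every earlier entry of `p` is larger than `p x` and
every later entry is smaller. By the law of large numbers the empirical frequencies inherit this
order almost surely for large `n`: finitely many comparisons follow from pointwise convergence, and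
the far tail carries less mass than `p x`. Neither sorting nor passing to the slopes of the least
concave majorant changes an entry with this property, since both operations then act separately on
the entries before and after it. Hence on `{r, …, s}` the rearrangement and Grenander estimators
eventually equal the empirical one, and everything reduces to the multivariate central limit
theorem for the vectors of indicators, which the Cramér–Wold device derives from the
one-dimensional one.
-/

namespace DiscreteMonotone

section Pivot

variable {α β : Type*}

/-- The entry of `w` at `x` is a pivot if no earlier entry is smaller and no later entry is larger.
Sorting the vector or passing to the slopes of its least concave majorant preserves such entries. -/
def IsPivot [LE α] [LE β] (w : α → β) (x : α) : Prop :=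
  (∀ i ≤ x, w x ≤ w i) ∧ ∀ i, x ≤ i → w i ≤ w x

/-- The strict form of `IsPivot`: the one that survives small perturbations of `w`. -/
def IsStrictPivot [LT α] [LT β] (w : α → β) (x : α) : Prop :=
  (∀ i < x, w x < w i) ∧ ∀ i, x < i → w i < w x

lemma exists_le_and_le_apply_of_injective [LinearOrder α] [Finite α] {f : α → α}
    (hf : f.Injective) (x : α) : ∃ i ≤ x, x ≤ f i := by
  by_contra! h
  have hcard : (Set.Iic x).ncard ≤ (Set.Iio x).ncard :=
    Set.ncard_le_ncard_of_injOn f h hf.injOn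
  exact hcard.not_gt (Set.ncard_lt_ncard (Set.Iio_ssubset_Iic_self))

lemma IsPivot.apply_perm_eq [LinearOrder α] [Finite α] [PartialOrder β] {w : α → β} {x : α}
    (hx : IsPivot w x) {σ : Equiv.Perm α} (hσ : Antitone (w ∘ σ)) : w (σ x) = w x := by
  obtain ⟨i, hix, hxi⟩ := exists_le_and_le_apply_of_injective σ.symm.injective x
  obtain ⟨j, hxj, hjx⟩ : ∃ j, x ≤ j ∧ σ.symm j ≤ x :=
    exists_le_and_le_apply_of_injective (α := αᵒᵈ) (f := σ.symm) σ.symm.injective x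
  refine le_antisymm ?_ ?_
  · calc w (σ x) ≤ w (σ (σ.symm j)) := hσ hjx
      _ = w j := by rw [σ.apply_symm_apply]
      _ ≤ w x := hx.2 j hxj
  · calc w x ≤ w i := hx.1 i hix
      _ = w (σ (σ.symm i)) := by rw [σ.apply_symm_apply]
      _ ≤ w (σ x) := hσ hxi

lemma isStrictPivot_of_antitone [Preorder β] {w : ℕ → β} (hw : Antitone w) {x : ℕ}
    (hpred : ∀ y, y + 1 = x → w x < w y) (hsucc : w (x + 1) < w x) : IsStrictPivot w x := by
  refine ⟨fun i hi => ?_, fun i hi => (hw hi).trans_lt hsucc⟩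
  obtain ⟨y, rfl⟩ : ∃ y, y + 1 = x := ⟨x - 1, by lia⟩
  exact (hpred y rfl).trans_le (hw (Nat.le_of_lt_succ hi))

lemma eventually_isPivot_of_tendsto {l : Filter α} {p : ℕ → ℝ} {q : α → ℕ → ℝ} {a : ℝ}
    (hp : HasSum p a) (hq_sum : ∀ n (F : Finset ℕ), ∑ i ∈ F, q n i ≤ a)
    (hq : ∀ i, Tendsto (fun n => q n i) l (𝓝 (p i))) {x : ℕ} (hx_pos : 0 < p x)
    (hx : IsStrictPivot p x) : ∀ᶠ n in l, IsPivot (q n) x := by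
  obtain ⟨N, hN⟩ : ∃ N, a - p x < ∑ i ∈ Finset.range N, p i :=
    (hp.tendsto_sum_nat.eventually_const_lt (sub_lt_self a hx_pos)).exists
  have mass : ∀ᶠ n in l, a - q n x < ∑ i ∈ Finset.range N, q n i :=
    (tendsto_const_nhds.sub (hq x)).eventually_lt (tendsto_finsetSum _ fun i _ => hq i) hN
  have before : ∀ᶠ n in l, ∀ i ∈ Finset.range x, q n x < q n i :=
    (Finset.eventually_all _).2 fun i hi =>
      (hq x).eventually_lt (hq i) (hx.1 i (Finset.mem_range.1 hi))
  have between : ∀ᶠ n in l, ∀ i ∈ Finset.Ioo x N, q n i < q n x :=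
    (Finset.eventually_all _).2 fun i hi =>
      (hq i).eventually_lt (hq x) (hx.2 i (Finset.mem_Ioo.1 hi).1)
  filter_upwards [mass, before, between] with n mass before between
  refine ⟨fun i hi => ?_, fun i hi => ?_⟩
  · rcases hi.eq_or_lt with rfl | hi
    · exact le_rfl
    · exact (before i (Finset.mem_range.2 hi)).le
  rcases hi.eq_or_lt with rfl | hi
  · exact le_rfl
  rcases lt_or_ge i N with hiN | hNi
  · exact (between i (Finset.mem_Ioo.2 ⟨hi, hiN⟩)).le
  · -- An entry beyond `N` is at most the mass that the first `N` entries leave.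
    have total := hq_sum n (insert i (Finset.range N))
    rw [Finset.sum_insert (by simpa using hNi)] at total
    linarith

/-- The property of a vector operator that makes the resulting estimator asymptotically equivalent
to the empirical one at the strict pivots of the mass function: no entry at a pivot is changed. -/
def FixesPivots (φ : ∀ {k : ℕ}, (Fin (k + 1) → ℝ) → Fin (k + 1) → ℝ) : Prop :=
  ∀ {k : ℕ} (w : Fin (k + 1) → ℝ) (x : Fin (k + 1)), IsPivot w x → φ w x = w x

lemma FixesPivots.applyUpTo_eq {φ : ∀ {k : ℕ}, (Fin (k + 1) → ℝ) → Fin (k + 1) → ℝ}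
    (hφ : FixesPivots φ) {M : ℕ} {w : ℕ → ℝ} (hw : ∀ x, M < x → w x = 0) {x : ℕ}
    (hx : IsPivot w x) : applyUpTo φ M w x = w x := by
  by_cases hxM : x < M + 1
  · rw [applyUpTo, dif_pos hxM]
    exact hφ _ ⟨x, hxM⟩ ⟨fun i hi => hx.1 i hi, fun i hi => hx.2 i hi⟩
  · rw [applyUpTo, dif_neg hxM, hw x (by lia)]

lemma antitone_rear {k : ℕ} (w : Fin (k + 1) → ℝ) : Antitone (rear w) := fun _ _ hij =>
  neg_le_neg_iff.1 (Tuple.monotone_sort (fun j => -w j) hij)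

lemma fixesPivots_rear : FixesPivots rear := fun w _ hx => hx.apply_perm_eq (antitone_rear w)

end Pivot

section LeastConcaveMajorant

lemma leastConcaveMajorant_eq_of_line {D : Set ℝ} (hD : Convex ℝ D) {Q : Set (ℝ × ℝ)} {t v c : ℝ}
    (hmem : (t, v) ∈ Q) (hline : ∀ q ∈ Q, q.2 ≤ v + c * (q.1 - t)) :
    leastConcaveMajorant D Q t = v := by
  have hconcave : ConcaveOn ℝ D fun y => v + c * (y - t) :=
    ⟨hD, fun x _ y _ a b _ _ hab => le_of_eq <| by
      simp only [smul_eq_mul]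
      linear_combination (v - c * t) * hab⟩
  refine IsLeast.csInf_eq ⟨⟨_, hconcave, hline, by simp⟩, ?_⟩
  rintro _ ⟨g, -, hg, rfl⟩
  exact hg _ hmem

variable {k m : ℕ} {w : Fin (k + 1) → ℝ} {c : ℝ}

lemma sum_ite_lt_sub_const (hm : m ≤ k + 1) (w : Fin (k + 1) → ℝ) (c : ℝ) :
    (∑ i : Fin (k + 1), if (i : ℕ) < m then w i - c else 0) =
      (∑ i : Fin (k + 1), if (i : ℕ) < m then w i else 0) - m * c := by
  simp only [← Finset.sum_filter, Finset.sum_sub_distrib, Finset.sum_const, nsmul_eq_mul,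
    Fin.card_filter_val_lt, min_eq_right hm]

lemma sum_ite_lt_le_add_mul {l : ℕ} (hl : l ≤ k + 1) (hm : m ≤ k + 1)
    (hbefore : ∀ i : Fin (k + 1), i < m → c ≤ w i) (hafter : ∀ i : Fin (k + 1), m ≤ i → w i ≤ c) :
    (∑ i : Fin (k + 1), if (i : ℕ) < l then w i else 0) ≤
      (∑ i : Fin (k + 1), if (i : ℕ) < m then w i else 0) + c * (l - m) := by
  have hle : (∑ i : Fin (k + 1), if (i : ℕ) < l then w i - c else 0) ≤
      ∑ i : Fin (k + 1), if (i : ℕ) < m then w i - c else 0 := by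
    refine Finset.sum_le_sum fun i _ => ?_
    rcases lt_or_ge (i : ℕ) m with him | hmi
    · have := hbefore i him
      split_ifs <;> linarith
    · have := hafter i hmi
      split_ifs <;> linarith
  rw [sum_ite_lt_sub_const hl, sum_ite_lt_sub_const hm] at hle
  linarith

lemma leastConcaveMajorant_cumulativePoints_eq (hm : m ≤ k + 1)
    (hbefore : ∀ i : Fin (k + 1), i < m → c ≤ w i) (hafter : ∀ i : Fin (k + 1), m ≤ i → w i ≤ c) :
    leastConcaveMajorant (Set.Icc (-1) (k : ℝ)) (cumulativePoints w) ((m : ℝ) - 1) =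
      ∑ i : Fin (k + 1), if (i : ℕ) < m then w i else 0 := by
  refine leastConcaveMajorant_eq_of_line (c := c) (convex_Icc _ _) ⟨m, hm, rfl⟩ ?_
  rintro _ ⟨l, hl, rfl⟩
  simpa only [sub_sub_sub_cancel_right] using sum_ite_lt_le_add_mul hl hm hbefore hafter

lemma sum_ite_lt_succ_sub_sum_ite_lt (w : Fin (k + 1) → ℝ) (x : Fin (k + 1)) :
    (∑ i : Fin (k + 1), if (i : ℕ) < x + 1 then w i else 0) -
      (∑ i : Fin (k + 1), if (i : ℕ) < x then w i else 0) = w x := by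
  rw [← Finset.sum_sub_distrib, Finset.sum_eq_single x (fun i _ hi => ?_) (by simp)]
  · simp
  · have : (i : ℕ) ≠ x := Fin.val_ne_of_ne hi
    split_ifs <;> first | lia | simp

-- The line of slope `w x` supports the cumulative points at both ends of `[x - 1, x]`.
lemma fixesPivots_gren : FixesPivots gren := by
  intro k w x hx
  have left := leastConcaveMajorant_cumulativePoints_eq (m := x) (c := w x) x.2.le
    (fun i hi => hx.1 i hi.le) hx.2
  have right := leastConcaveMajorant_cumulativePoints_eq (m := x + 1) (c := w x) x.2
    (fun i hi => hx.1 i (Nat.le_of_lt_succ hi)) (fun i hi => hx.2 i (Nat.le_of_succ_le hi))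
  rw [Nat.cast_add_one, add_sub_cancel_right] at right
  change gren w x = w x
  rw [gren, left, right, sum_ite_lt_succ_sub_sum_ite_lt]

end LeastConcaveMajorant

section LimitTheorems

open scoped RealInnerProductSpace

variable {Ω Ω' : Type*} [MeasurableSpace Ω] {P : Measure Ω} [MeasurableSpace Ω'] {P' : Measure Ω'}

lemma tendstoInMeasure_of_ae_eventually_eq {E : Type*} [PseudoEMetricSpace E]
    [IsFiniteMeasure P] {f : ℕ → Ω → E} {g : Ω → E}
    (hf : ∀ n, AEStronglyMeasurable (f n) P) (h : ∀ᵐ ω ∂P, ∀ᶠ n in atTop, f n ω = g ω) :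
    TendstoInMeasure P f atTop g :=
  tendstoInMeasure_of_tendsto_ae hf (h.mono fun _ hω => tendsto_nhds_of_eventually_eq hω)

lemma tendstoInDistribution_of_ae_eventually_eq {E : Type*} [SeminormedAddCommGroup E]
    [SecondCountableTopology E] [MeasurableSpace E] [BorelSpace E] [IsProbabilityMeasure P]
    [IsProbabilityMeasure P'] {f g : ℕ → Ω → E} {Z : Ω' → E}
    (hf : TendstoInDistribution f atTop Z (fun _ => P) P') (hg : ∀ n, AEMeasurable (g n) P)
    (h : ∀ᵐ ω ∂P, ∀ᶠ n in atTop, g n ω = f n ω) :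
    TendstoInDistribution g atTop Z (fun _ => P) P' := by
  refine tendstoInDistribution_of_tendstoInMeasure_sub g Z hf ?_ hg
  refine tendstoInMeasure_of_ae_eventually_eq
    (fun n => ((hg n).sub (hf.forall_aemeasurable n)).aestronglyMeasurable) ?_
  filter_upwards [h] with ω hω
  filter_upwards [hω] with n hn using sub_eq_zero.2 hn

section CramerWold

variable {E : Type*} [NormedAddCommGroup E] [InnerProductSpace ℝ E] [MeasurableSpace E]
  [BorelSpace E]

lemma charFun_map_inner [SecondCountableTopology E] {X : Ω → E} (hX : AEMeasurable X P) (t : E) :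
    charFun (P.map fun ω => ⟪t, X ω⟫) 1 = charFun (P.map X) t := by
  rw [charFun_apply, charFun_apply, integral_map (by fun_prop) (by fun_prop),
    integral_map hX (by fun_prop)]
  simp [real_inner_comm]

lemma hasLaw_inner_of_integral_eq_zero [CompleteSpace E] [SecondCountableTopology E] {X : Ω → E}
    (hX : HasGaussianLaw X P) (hX_mean : P[X] = 0) {t : E} {v : ℝ}
    (hvar : Var[fun ω => ⟪t, X ω⟫; P] = v) :
    HasLaw (fun ω => ⟪t, X ω⟫) (gaussianReal 0 v.toNNReal) P := by
  have hgauss : HasGaussianLaw (fun ω => ⟪t, X ω⟫) P := hX.map_fun (innerSL ℝ t)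
  refine ⟨hgauss.aemeasurable, ?_⟩
  rw [hgauss.map_eq_gaussianReal, integral_inner hX.integrable, hX_mean, inner_zero_right, hvar]

variable [IsProbabilityMeasure P']

lemma tendstoInDistribution_of_forall_inner [FiniteDimensional ℝ E] {Ω : ℕ → Type*}
    [∀ n, MeasurableSpace (Ω n)] {P : ∀ n, Measure (Ω n)} [∀ n, IsProbabilityMeasure (P n)]
    {X : ∀ n, Ω n → E} {Z : Ω' → E} (hX : ∀ n, AEMeasurable (X n) (P n)) (hZ : AEMeasurable Z P')
    (h : ∀ t : E, TendstoInDistribution (fun n ω => ⟪t, X n ω⟫) atTop (fun ω => ⟪t, Z ω⟫) P P') :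
    TendstoInDistribution X atTop Z P P' where
  forall_aemeasurable := hX
  aemeasurable_limit := hZ
  tendsto := by
    refine ProbabilityMeasure.tendsto_iff_tendsto_charFun.2 fun t => ?_
    have hline := ProbabilityMeasure.tendsto_iff_tendsto_charFun.1 (h t).tendsto 1
    simpa only [ProbabilityMeasure.coe_mk, charFun_map_inner hZ, charFun_map_inner (hX _)]
      using hline

variable [IsProbabilityMeasure P]

lemma tendstoInDistribution_inv_sqrt_smul_sum_sub [FiniteDimensional ℝ E] {X : ℕ → Ω → E}
    {Z : Ω' → E} (hZ : HasGaussianLaw Z P') (hZ_mean : P'[Z] = 0)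
    (hvar : ∀ t : E, Var[fun ω => ⟪t, Z ω⟫; P'] = Var[fun ω => ⟪t, X 0 ω⟫; P])
    (hX : MemLp (X 0) 2 P) (hindep : iIndepFun X P)
    (hident : ∀ i, IdentDistrib (X i) (X 0) P P) :
    TendstoInDistribution
      (fun (n : ℕ) ω => (√(n : ℝ))⁻¹ • (∑ i ∈ Finset.range n, X i ω - (n : ℝ) • P[X 0])) atTop Z
      (fun _ => P) P' := by
  have hX_meas (i : ℕ) : AEMeasurable (X i) P := (hident i).aemeasurable_fst
  refine tendstoInDistribution_of_forall_inner (fun n => ?_) hZ.aemeasurable fun t => ?_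
  · exact ((Finset.aemeasurable_fun_sum _ fun i _ => hX_meas i).sub_const _).const_smul _
  have hinner : Measurable fun y : E => ⟪t, y⟫ := (innerSL ℝ t).measurable
  have hclt := tendstoInDistribution_inv_sqrt_mul_sum_sub (X := fun i ω => ⟪t, X i ω⟫)
    (hasLaw_inner_of_integral_eq_zero hZ hZ_mean (hvar t)) (hX.const_inner t)
    (hindep.comp (fun _ y => ⟪t, y⟫) fun _ => hinner) fun i => (hident i).comp hinner
  refine hclt.congr (fun n => .of_forall fun ω => ?_) .rfl
  simp only [integral_inner (hX.integrable one_le_two), inner_smul_right, inner_sub_right,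
    inner_sum]

variable {ι : Type*} [Fintype ι]

lemma variance_inner_toLp {X : Ω → ι → ℝ} (hX : MemLp X 2 P) (t : EuclideanSpace ℝ ι) :
    Var[fun ω => ⟪t, WithLp.toLp 2 (X ω)⟫; P] =
      ∑ i, ∑ j, t i * t j * cov[fun ω => X ω i, fun ω => X ω j; P] := by
  have hcoord (i : ι) : MemLp (fun ω => t i * X ω i) 2 P := (hX.eval i).const_mul _
  have hinner : (fun ω => ⟪t, WithLp.toLp 2 (X ω)⟫) = fun ω => ∑ i, t i * X ω i := by
    ext ω
    simp [PiLp.inner_apply, mul_comm]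
  rw [hinner, ← covariance_self (memLp_finsetSum _ fun i _ => hcoord i).aemeasurable,
    covariance_fun_sum_fun_sum hcoord hcoord]
  simp only [covariance_const_mul_left, covariance_const_mul_right, mul_assoc, mul_left_comm]

lemma tendstoInDistribution_inv_sqrt_smul_sum_sub_pi {X : ℕ → Ω → ι → ℝ} {Z : Ω' → ι → ℝ}
    (hZ : HasGaussianLaw Z P') (hZ_mean : P'[Z] = 0)
    (hcov : ∀ i j, cov[fun ω => Z ω i, fun ω => Z ω j; P'] =
      cov[fun ω => X 0 ω i, fun ω => X 0 ω j; P])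
    (hX : MemLp (X 0) 2 P) (hindep : iIndepFun X P)
    (hident : ∀ i, IdentDistrib (X i) (X 0) P P) :
    TendstoInDistribution
      (fun (n : ℕ) ω => (√(n : ℝ))⁻¹ • (∑ i ∈ Finset.range n, X i ω - (n : ℝ) • P[X 0])) atTop Z
      (fun _ => P) P' := by
  let L : (ι → ℝ) ≃L[ℝ] EuclideanSpace ℝ ι := (EuclideanSpace.equiv ι ℝ).symm
  have hL : Measurable L := L.continuous.measurable
  have hclt := tendstoInDistribution_inv_sqrt_smul_sum_sub (X := fun i => L ∘ X i)
    (hZ.map_equiv L)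
    ((L.integral_comp_comm Z).trans (by rw [hZ_mean, map_zero]))
    (fun t => by
      refine (variance_inner_toLp hZ.memLp_two t).trans ?_
      simp only [hcov]
      exact (variance_inner_toLp hX t).symm)
    (L.toContinuousLinearMap.comp_memLp' hX) (hindep.comp _ fun _ => hL)
    fun i => (hident i).comp hL
  have hmean : P[L ∘ X 0] = L P[X 0] := L.integral_comp_comm (X 0)
  refine (hclt.continuous_comp L.symm.continuous).congr (fun n => .of_forall fun ω => ?_)
    (.of_forall fun ω => L.symm_apply_apply (Z ω))
  rw [hmean]
  simp only [Function.comp_apply, ← map_sum, ← map_smul, ← map_sub, L.symm_apply_apply]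

end CramerWold

end LimitTheorems

section DiscreteRandomVariables

variable {Ω α : Type*}

lemma ite_eq_eq_indicator_preimage [DecidableEq α] (X : Ω → α) (a : α) :
    (fun ω => if X ω = a then (1 : ℝ) else 0) = (X ⁻¹' {a}).indicator 1 := by
  ext ω
  simp [Set.indicator]

variable [MeasurableSpace Ω] {P : Measure Ω}

lemma covariance_indicator_one [IsProbabilityMeasure P] {A B : Set Ω} (hA : MeasurableSet A)
    (hB : MeasurableSet B) :
    cov[A.indicator 1, B.indicator 1; P] = P.real (A ∩ B) - P.real A * P.real B := by
  have hmemLp {C : Set Ω} (hC : MeasurableSet C) : MemLp (C.indicator (1 : Ω → ℝ)) 2 P :=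
    memLp_indicator_const 2 hC 1 (.inr (measure_ne_top _ _))
  rw [covariance_eq_sub (hmemLp hA) (hmemLp hB), ← Set.inter_indicator_one,
    integral_indicator_one hA, integral_indicator_one hB, integral_indicator_one (hA.inter hB)]

variable [MeasurableSpace α] [MeasurableSingletonClass α]

lemma memLp_ite_eq [DecidableEq α] [IsFiniteMeasure P] {X : Ω → α} (hX : Measurable X) (a : α)
    (q : ENNReal) : MemLp (fun ω => if X ω = a then (1 : ℝ) else 0) q P := by
  rw [ite_eq_eq_indicator_preimage]
  exact memLp_indicator_const q (hX (measurableSet_singleton a)) 1 (.inr (measure_ne_top _ _))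

lemma integral_ite_eq [DecidableEq α] {X : Ω → α} (hX : Measurable X) (a : α) :
    ∫ ω, (if X ω = a then (1 : ℝ) else 0) ∂P = P.real (X ⁻¹' {a}) := by
  rw [ite_eq_eq_indicator_preimage, integral_indicator_one (hX (measurableSet_singleton a))]

lemma covariance_ite_eq [DecidableEq α] [IsProbabilityMeasure P] {X : Ω → α} (hX : Measurable X)
    (a b : α) :
    cov[fun ω => if X ω = a then (1 : ℝ) else 0, fun ω => if X ω = b then (1 : ℝ) else 0; P] =
      (if a = b then P.real (X ⁻¹' {a}) else 0) - P.real (X ⁻¹' {a}) * P.real (X ⁻¹' {b}) := by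
  rw [ite_eq_eq_indicator_preimage, ite_eq_eq_indicator_preimage,
    covariance_indicator_one (hX (measurableSet_singleton a)) (hX (measurableSet_singleton b)),
    ← Set.preimage_inter]
  split_ifs with hab
  · rw [hab, Set.inter_self]
  · rw [(Set.disjoint_singleton.2 hab).inter_eq, Set.preimage_empty, measureReal_empty]

variable [Countable α]

lemma hasSum_measureReal_preimage_singleton [IsProbabilityMeasure P] {X : Ω → α}
    (hX : Measurable X) : HasSum (fun a => P.real (X ⁻¹' {a})) 1 := by
  have hfibers := hasSum_integral_iUnion (f := fun _ => (1 : ℝ)) (μ := P)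
    (fun a => hX (measurableSet_singleton a)) (pairwise_disjoint_fiber X)
    (integrable_const 1).integrableOn
  simpa only [← Set.preimage_iUnion, Set.iUnion_of_singleton, Set.preimage_univ, setIntegral_const,
    probReal_univ, smul_eq_mul, mul_one] using hfibers

lemma identDistrib_of_measureReal_preimage_singleton {Ω' : Type*} [MeasurableSpace Ω']
    {P' : Measure Ω'} [IsFiniteMeasure P] [IsFiniteMeasure P'] {X : Ω → α} {X' : Ω' → α}
    (hX : Measurable X) (hX' : Measurable X')
    (h : ∀ a, P.real (X ⁻¹' {a}) = P'.real (X' ⁻¹' {a})) : IdentDistrib X X' P P' where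
  aemeasurable_fst := hX.aemeasurable
  aemeasurable_snd := hX'.aemeasurable
  map_eq := Measure.ext_of_singleton fun a => by
    rw [Measure.map_apply hX (measurableSet_singleton a),
      Measure.map_apply hX' (measurableSet_singleton a)]
    exact (measureReal_eq_measureReal_iff (measure_ne_top _ _) (measure_ne_top _ _)).1 (h a)

lemma measurable_of_factorsThrough {γ : Type*} [MeasurableSpace γ] {X : Ω → α} (hX : Measurable X)
    {g : Ω → γ} (hg : g.FactorsThrough X) : Measurable g := by
  intro S _
  have hpreimage : g ⁻¹' S = X ⁻¹' (X '' (g ⁻¹' S)) := by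
    refine (Set.subset_preimage_image X _).antisymm ?_
    rintro ω ⟨ω', hω', h⟩
    rwa [Set.mem_preimage, ← hg h]
  rw [hpreimage]
  exact hX (Set.to_countable _).measurableSet

end DiscreteRandomVariables

section LimitProcess

lemma separableSpace_lp {ι : Type*} [Countable ι] {E : ι → Type*} [∀ i, NormedAddCommGroup (E i)]
    [∀ i, NormedSpace ℝ (E i)] [∀ i, TopologicalSpace.SeparableSpace (E i)] {q : ENNReal}
    [Fact (1 ≤ q)] (hq : q ≠ ⊤) : TopologicalSpace.SeparableSpace (lp E q) := by
  classical
  have hsep : TopologicalSpace.IsSeparable (⋃ i, Set.range (lp.single q (E := E) i)) :=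
    .iUnion fun i => TopologicalSpace.isSeparable_range (lp.isometry_single i).continuous
  refine TopologicalSpace.isSeparable_univ_iff.1 ((hsep.span (R := ℝ)).closure.mono fun f _ => ?_)
  refine mem_closure_of_tendsto (lp.hasSum_single hq f)
    (.of_forall fun F => Submodule.sum_mem _ fun i _ => Submodule.subset_span ?_)
  exact Set.mem_iUnion.2 ⟨i, f i, rfl⟩

/-- The restriction `segment r s` to square summable sequences, as a continuous linear map. -/
noncomputable def segmentCLM (r s : ℕ) : Ell2 →L[ℝ] (Finset.Icc r s → ℝ) :=
  .pi fun x => lp.evalCLM ℝ (fun _ : ℕ => ℝ) 2 (x : ℕ)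

variable {Ω' : Type*} [MeasurableSpace Ω'] {P' : Measure Ω'} {p : ℕ → ℝ} {Y : Ω' → Ell2}

lemma IsLimitProcess.hasGaussianLaw_segment (hY : IsLimitProcess p P' Y) (r s : ℕ) :
    HasGaussianLaw (fun ω => segment r s (Y ω)) P' :=
  hY.gaussian.map_fun (segmentCLM r s)

lemma IsLimitProcess.integral_segment (hY : IsLimitProcess p P' Y) (r s : ℕ) :
    ∫ ω, segment r s (Y ω) ∂P' = 0 := by
  have : TopologicalSpace.SeparableSpace Ell2 := separableSpace_lp ENNReal.ofNat_ne_top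
  have : SecondCountableTopology Ell2 := UniformSpace.secondCountable_of_separable Ell2
  refine ((segmentCLM r s).integral_comp_comm hY.gaussian.integrable).trans ?_
  rw [hY.mean_zero, map_zero]

end LimitProcess

section Sample

variable {Ω : Type*} {X : ℕ → Ω → ℕ} {n : ℕ}

lemma sum_empirical_le_one (X : ℕ → Ω → ℕ) (n : ℕ) (ω : Ω) (F : Finset ℕ) :
    ∑ x ∈ F, empirical X n ω x ≤ 1 := by
  have hcount (i : ℕ) : ∑ x ∈ F, (if X i ω = x then (1 : ℝ) else 0) ≤ 1 := by
    rw [Finset.sum_ite_eq]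
    split_ifs <;> norm_num
  calc ∑ x ∈ F, empirical X n ω x
      = (n : ℝ)⁻¹ * ∑ i ∈ Finset.range n, ∑ x ∈ F, (if X i ω = x then (1 : ℝ) else 0) := by
        simp only [empirical, ← Finset.mul_sum]
        rw [Finset.sum_comm]
    _ ≤ (n : ℝ)⁻¹ * ∑ i ∈ Finset.range n, 1 := by gcongr; exact hcount _
    _ ≤ 1 := by simpa using inv_mul_le_one

lemma empirical_eq_zero_of_sampleMax_lt {ω : Ω} {x : ℕ} (hx : sampleMax X n ω < x) :
    empirical X n ω x = 0 := by
  have hne (i : ℕ) (hi : i ∈ Finset.range n) : X i ω ≠ x :=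
    ((Finset.le_sup (f := fun i => X i ω) hi).trans_lt hx).ne
  rw [empirical, Finset.sum_eq_zero fun i hi => if_neg (hne i hi), mul_zero]

lemma segment_fluctuation_empirical (X : ℕ → Ω → ℕ) (n : ℕ) (ω : Ω) (p : ℕ → ℝ) (r s : ℕ) :
    segment r s (fluctuation n (empirical X n ω) p) =
      (√(n : ℝ))⁻¹ • (∑ i ∈ Finset.range n,
        (fun x : Finset.Icc r s => if X i ω = x then (1 : ℝ) else 0) -
          (n : ℝ) • segment r s p) := by
  ext x
  simp only [segment, fluctuation, empirical, Pi.smul_apply, Pi.sub_apply, Finset.sum_apply,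
    smul_eq_mul]
  rcases n.eq_zero_or_pos with rfl | hn
  · simp
  · have hsqrt : √(n : ℝ) ^ 2 = n := Real.sq_sqrt n.cast_nonneg
    field_simp
    rw [hsqrt]

lemma empirical_factorsThrough (X : ℕ → Ω → ℕ) (n : ℕ) :
    (empirical X n).FactorsThrough fun ω (i : Fin n) => X i ω := by
  intro ω ω' h
  ext x
  simp only [empirical]
  congr 1
  refine Finset.sum_congr rfl fun i hi => ?_
  have hi_eq : X i ω = X i ω' := congrFun h ⟨i, Finset.mem_range.1 hi⟩
  rw [hi_eq]

lemma sampleMax_factorsThrough (X : ℕ → Ω → ℕ) (n : ℕ) :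
    (sampleMax X n).FactorsThrough fun ω (i : Fin n) => X i ω :=
  fun _ _ h => Finset.sup_congr rfl fun i hi => congrFun h ⟨i, Finset.mem_range.1 hi⟩

variable [MeasurableSpace Ω]

lemma measurable_sample (hX : ∀ i, Measurable (X i)) (n : ℕ) :
    Measurable fun ω (i : Fin n) => X i ω :=
  measurable_pi_lambda _ fun i => hX i

lemma measurable_empirical (hX : ∀ i, Measurable (X i)) (n : ℕ) : Measurable (empirical X n) :=
  measurable_of_factorsThrough (measurable_sample hX n) (empirical_factorsThrough X n)

lemma measurable_applyUpTo_empirical (φ : ∀ {k : ℕ}, (Fin (k + 1) → ℝ) → Fin (k + 1) → ℝ)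
    (hX : ∀ i, Measurable (X i)) (n : ℕ) :
    Measurable fun ω => applyUpTo φ (sampleMax X n ω) (empirical X n ω) :=
  measurable_of_factorsThrough (measurable_sample hX n) fun ω ω' h => by
    simp only [sampleMax_factorsThrough X n h, empirical_factorsThrough X n h]

lemma measurable_segment_fluctuation (r s n : ℕ) (p : ℕ → ℝ) {q : Ω → ℕ → ℝ} (hq : Measurable q) :
    Measurable fun ω => segment r s (fluctuation n (q ω) p) :=
  measurable_pi_lambda _ fun x => ((measurable_pi_iff.1 hq x).sub_const _).const_mul _

variable {P : Measure Ω} [IsProbabilityMeasure P] {Ω' : Type*} [MeasurableSpace Ω']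
  {P' : Measure Ω'} [IsProbabilityMeasure P'] {p : ℕ → ℝ} {Y : Ω' → Ell2} {r s x : ℕ}

lemma ae_tendsto_empirical (hX_meas : ∀ i, Measurable (X i)) (hX_indep : iIndepFun X P)
    (hX_law : ∀ i x, P.real (X i ⁻¹' {x}) = p x) :
    ∀ᵐ ω ∂P, ∀ x, Tendsto (fun n => empirical X n ω x) atTop (𝓝 (p x)) := by
  refine ae_all_iff.2 fun x => ?_
  have hind : Measurable fun y : ℕ => if y = x then (1 : ℝ) else 0 := measurable_of_countable _
  have hslln := strong_law_ae (μ := P) (fun i ω => if X i ω = x then (1 : ℝ) else 0)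
    ((memLp_ite_eq (hX_meas 0) x 1).integrable le_rfl)
    (fun i j hij => (hX_indep.indepFun hij).comp hind hind)
    (fun i => (identDistrib_of_measureReal_preimage_singleton (hX_meas i) (hX_meas 0)
      fun y => (hX_law i y).trans (hX_law 0 y).symm).comp hind)
  rwa [integral_ite_eq (hX_meas 0), hX_law] at hslln

lemma tendstoInDistribution_segment_empirical (hX_meas : ∀ i, Measurable (X i))
    (hX_indep : iIndepFun X P) (hX_law : ∀ i x, P.real (X i ⁻¹' {x}) = p x)
    (hY : IsLimitProcess p P' Y) (r s : ℕ) :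
    TendstoInDistribution (fun n ω => segment r s (fluctuation n (empirical X n ω) p)) atTop
      (fun ω' => segment r s (Y ω')) (fun _ => P) P' := by
  let ind (y : ℕ) : Finset.Icc r s → ℝ := fun x => if y = x then 1 else 0
  have hind : Measurable ind := measurable_of_countable _
  have hmemLp : MemLp (ind ∘ X 0) 2 P := MemLp.of_eval fun x => memLp_ite_eq (hX_meas 0) x 2
  have hmean : ∫ ω, ind (X 0 ω) ∂P = segment r s p := by
    ext x
    refine (eval_integral (fun z => (hmemLp.eval z).integrable one_le_two) x).trans ?_
    exact (integral_ite_eq (hX_meas 0) _).trans (hX_law 0 x)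
  have hclt := tendstoInDistribution_inv_sqrt_smul_sum_sub_pi (X := fun i => ind ∘ X i)
    (hY.hasGaussianLaw_segment r s) (hY.integral_segment r s)
    (fun x z => (hY.covariance x z).trans <| by
      simp only [← hX_law 0]
      exact (covariance_ite_eq (hX_meas 0) _ _).symm)
    hmemLp (hX_indep.comp _ fun _ => hind)
    fun i => (identDistrib_of_measureReal_preimage_singleton (hX_meas i) (hX_meas 0)
      fun y => (hX_law i y).trans (hX_law 0 y).symm).comp hind
  refine hclt.congr (fun n => .of_forall fun ω => ?_) .rfl
  simp only [Function.comp_apply, hmean]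
  exact (segment_fluctuation_empirical X n ω p r s).symm

variable {φ : ∀ {k : ℕ}, (Fin (k + 1) → ℝ) → Fin (k + 1) → ℝ}

lemma FixesPivots.ae_eventually_applyUpTo_eq (hφ : FixesPivots φ) (hX_meas : ∀ i, Measurable (X i))
    (hX_indep : iIndepFun X P) (hX_law : ∀ i x, P.real (X i ⁻¹' {x}) = p x)
    (hx : IsStrictPivot p x) :
    ∀ᵐ ω ∂P, ∀ᶠ n in atTop,
      applyUpTo φ (sampleMax X n ω) (empirical X n ω) x = empirical X n ω x := by
  have hp_sum : HasSum p 1 := by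
    simpa only [hX_law] using hasSum_measureReal_preimage_singleton (P := P) (hX_meas 0)
  have hx_pos : 0 < p x := by
    have hsucc_nonneg : 0 ≤ p (x + 1) := hX_law 0 (x + 1) ▸ measureReal_nonneg
    exact hsucc_nonneg.trans_lt (hx.2 _ x.lt_succ_self)
  filter_upwards [ae_tendsto_empirical hX_meas hX_indep hX_law] with ω hω
  filter_upwards [eventually_isPivot_of_tendsto hp_sum (fun n => sum_empirical_le_one X n ω) hω
    hx_pos hx] with n hn
  exact hφ.applyUpTo_eq (fun _ => empirical_eq_zero_of_sampleMax_lt) hn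

lemma FixesPivots.tendstoInDistribution_segment_applyUpTo (hφ : FixesPivots φ)
    (hX_meas : ∀ i, Measurable (X i)) (hX_indep : iIndepFun X P)
    (hX_law : ∀ i x, P.real (X i ⁻¹' {x}) = p x) (hY : IsLimitProcess p P' Y)
    (h_pivot : ∀ x, r ≤ x → x ≤ s → IsStrictPivot p x) :
    TendstoInDistribution
      (fun n ω => segment r s (fluctuation n
        (applyUpTo φ (sampleMax X n ω) (empirical X n ω)) p))
      atTop (fun ω' => segment r s (Y ω')) (fun _ => P) P' := by
  refine tendstoInDistribution_of_ae_eventually_eq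
    (tendstoInDistribution_segment_empirical hX_meas hX_indep hX_law hY r s)
    (fun n => (measurable_segment_fluctuation r s n p
      (measurable_applyUpTo_empirical φ hX_meas n)).aemeasurable) ?_
  have hagree : ∀ᵐ ω ∂P, ∀ x : Finset.Icc r s, ∀ᶠ n in atTop,
      applyUpTo φ (sampleMax X n ω) (empirical X n ω) x = empirical X n ω x :=
    ae_all_iff.2 fun x => hφ.ae_eventually_applyUpTo_eq hX_meas hX_indep hX_law
      (h_pivot x (Finset.mem_Icc.1 x.2).1 (Finset.mem_Icc.1 x.2).2)
  filter_upwards [hagree] with ω hω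
  filter_upwards [eventually_all.2 hω] with n hn
  ext x
  simp only [segment, fluctuation, hn x]

lemma FixesPivots.tendstoInMeasure_sqrt_mul_applyUpTo_sub_empirical (hφ : FixesPivots φ)
    (hX_meas : ∀ i, Measurable (X i)) (hX_indep : iIndepFun X P)
    (hX_law : ∀ i x, P.real (X i ⁻¹' {x}) = p x) (hx : IsStrictPivot p x) :
    TendstoInMeasure P
      (fun (n : ℕ) ω => √(n : ℝ) *
        (applyUpTo φ (sampleMax X n ω) (empirical X n ω) x - empirical X n ω x))
      atTop (fun _ => 0) := by
  refine tendstoInMeasure_of_ae_eventually_eq (fun n => Measurable.aestronglyMeasurable ?_) ?_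
  · exact ((measurable_pi_iff.1 (measurable_applyUpTo_empirical φ hX_meas n) x).sub
      (measurable_pi_iff.1 (measurable_empirical hX_meas n) x)).const_mul _
  filter_upwards [hφ.ae_eventually_applyUpTo_eq hX_meas hX_indep hX_law hx] with ω hω
  filter_upwards [hω] with n hn
  rw [hn, sub_self, mul_zero]

end Sample

end DiscreteMonotone

open DiscreteMonotone in
theorem mainTheorem7_general
    {Ω : Type*} [MeasurableSpace Ω] (P : Measure Ω) [IsProbabilityMeasure P]
    {Ω' : Type*} [MeasurableSpace Ω'] (P' : Measure Ω') [IsProbabilityMeasure P']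
    (p : ℕ → ℝ) (X : ℕ → Ω → ℕ) (hX_meas : ∀ i, Measurable (X i)) (hX_indep : iIndepFun X P)
    (hX_law : ∀ i x, P.real (X i ⁻¹' {x}) = p x) (Y : Ω' → Ell2) (hY : IsLimitProcess p P' Y)
    (r s : ℕ) (h_pivot : ∀ x, r ≤ x → x ≤ s → IsStrictPivot p x) :
    TendstoInDistribution (fun n ω => segment r s (fluctuation n (empirical X n ω) p))
        atTop (fun ω' => segment r s (Y ω')) (fun _ => P) P' ∧
      TendstoInDistribution
        (fun n ω => segment r s (fluctuation n (rearrangementEstimator X n ω) p))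
        atTop (fun ω' => segment r s (Y ω')) (fun _ => P) P' ∧
      TendstoInDistribution (fun n ω => segment r s (fluctuation n (grenanderEstimator X n ω) p))
        atTop (fun ω' => segment r s (Y ω')) (fun _ => P) P' ∧
      ∀ x, r ≤ x → x ≤ s →
        TendstoInMeasure P
          (fun (n : ℕ) ω => √(n : ℝ) * (grenanderEstimator X n ω x - empirical X n ω x))
          atTop (fun _ => 0) :=
  ⟨tendstoInDistribution_segment_empirical hX_meas hX_indep hX_law hY r s,
    fixesPivots_rear.tendstoInDistribution_segment_applyUpTo hX_meas hX_indep hX_law hY h_pivot,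
    fixesPivots_gren.tendstoInDistribution_segment_applyUpTo hX_meas hX_indep hX_law hY h_pivot,
    fun x hrx hxs => fixesPivots_gren.tendstoInMeasure_sqrt_mul_applyUpTo_sub_empirical hX_meas
      hX_indep hX_law (h_pivot x hrx hxs)⟩

theorem mainTheorem7
    {Ω : Type*} [MeasurableSpace Ω] (P : Measure Ω) [IsProbabilityMeasure P]
    {Ω' : Type*} [MeasurableSpace Ω'] (P' : Measure Ω') [IsProbabilityMeasure P']
    (p : ℕ → ℝ) (hp_nonneg : ∀ x, 0 ≤ p x) (hp_sum : HasSum p 1) (hp_anti : Antitone p)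
    (X : ℕ → Ω → ℕ) (hX_meas : ∀ i, Measurable (X i)) (hX_indep : iIndepFun X P)
    (hX_law : ∀ i x, P.real (X i ⁻¹' {x}) = p x)
    (Y : Ω' → DiscreteMonotone.Ell2) (hY : DiscreteMonotone.IsLimitProcess p P' Y)
    (r s : ℕ) (hrs : r ≤ s)
    (h_strict : ∀ x, r ≤ x + 1 → x ≤ s → p (x + 1) < p x) :
    TendstoInDistribution
        (fun n ω => DiscreteMonotone.segment r s (DiscreteMonotone.fluctuation n
          (DiscreteMonotone.empirical X n ω) p))
        atTop (fun ω' => DiscreteMonotone.segment r s (Y ω')) (fun _ => P) P' ∧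
      TendstoInDistribution
        (fun n ω => DiscreteMonotone.segment r s (DiscreteMonotone.fluctuation n
          (DiscreteMonotone.rearrangementEstimator X n ω) p))
        atTop (fun ω' => DiscreteMonotone.segment r s (Y ω')) (fun _ => P) P' ∧
      TendstoInDistribution
        (fun n ω => DiscreteMonotone.segment r s (DiscreteMonotone.fluctuation n
          (DiscreteMonotone.grenanderEstimator X n ω) p))
        atTop (fun ω' => DiscreteMonotone.segment r s (Y ω')) (fun _ => P) P' ∧
      ∀ x, r ≤ x → x ≤ s →
        TendstoInMeasure P
          (fun (n : ℕ) ω => √(n : ℝ) *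
            (DiscreteMonotone.grenanderEstimator X n ω x - DiscreteMonotone.empirical X n ω x))
          atTop (fun _ => 0) :=
  mainTheorem7_general P P' p X hX_meas hX_indep hX_law Y hY r s fun x hrx hxs =>
    DiscreteMonotone.isStrictPivot_of_antitone hp_anti
      (fun y hy => hy ▸ h_strict y (by lia) (by lia)) (h_strict x (by lia) hxs)
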